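/- Let $\mathcal G$ be a tree on the buses $\{0,1,\dots,N\}$, rooted at the slack bus $0$, in which every line $e$ has an impedance $z_e=r_e+\mathrm i x_e\neq 0$ with $r_e,x_e\ge 0$ and admittance $y_e=1/z_e$. Let $\mathbf Y\in\mathbb C^{(N+1)\times(N+1)}$ be the admittance bus matrix, $Y_{jk}=-y_{jk}$ for $j\ne k$ and $Y_{jj}=\sum_{m\neq j}y_{jm}$ (with $y_{jk}=0$ if $j,k$ are not joined by a line), let $\mathbf Y_{LL}$ be its submatrix on the buses $1,\dots,N$, and $\mathbf Z=\mathbf Y_{LL}^{-1}$. Let $\mathcal P(j)$ be the set of lines on the path from $j$ to $0$, and let $\mathbf R,\mathbf X\in\mathbb R^{N\times N}$ be given by $R_{jk}=\sum_{e\in\mathcal P(j)\cap\mathcal P(k)}r_e$ and $X_{jk}=\sum_{e\in\mathcal P(j)\cap\mathcal P(k)}x_e$. Put $$\mathbf A=\begin{pmatrix}-(\mathbf R+\mathbf X)&-(-\mathbf R+\mathbf X)&\mathbf R+\mathbf X&-\mathbf R+\mathbf X\\-(-\mathbf R+\mathbf X)&-(-\mathbf R-\mathbf X)&-\mathbf R+\mathbf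 X&-\mathbf R-\mathbf X\\-(\mathbf R-\mathbf X)&-(\mathbf R+\mathbf X)&\mathbf R-\mathbf X&\mathbf R+\mathbf X\\-(-\mathbf R-\mathbf X)&-(\mathbf R-\mathbf X)&-\mathbf R-\mathbf X&\mathbf R-\mathbf X\end{pmatrix},\quad \mathbf B=\mathbf J_4\otimes(\mathbf R+\mathbf X),\quad \mathbf C=\mathbf J_4\otimes|\mathbf Z|,$$ where $\mathbf J_4$ is the $4\times4$ all-ones matrix and $|\mathbf Z|$ is the entrywise modulus. Let $V_0\in\mathbb C\setminus\{0\}$ be the slack voltage and $\Delta\in[0,1)$. A split load vector $\tilde{\mathbf s}=(\mathbf p^c,\mathbf q^c,\mathbf p^g,\mathbf q^g)\in\mathbb R_+^{4N}$ has the complex load $\mathbf s=(\mathbf p^c-\mathbf p^g)+\mathrm i(\mathbf q^c-\mathbf q^g)$. For a base point with voltage $\hat{\mathbf V}\in\mathbb C^N$ and split load $\tilde{\hat{\mathbf s}}$, let $\hat V_{\min}=\min_j|\hat V_j|$ and $$P=\Big\{\tilde{\mathbf s}\in\mathbb R_+^{4N}:(\mathbf A+\Delta\mathbf B)\tilde{\mathbf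 s}\le\Delta(1-\Delta)^2\hat V_{\min}^3\mathbf 1+\big(\mathbf A-\Delta(\mathbf B+(1-\Delta)\mathbf C)\big)\tilde{\hat{\mathbf s}}\Big\}.$$ Let $S$ be the set of all $\tilde{\mathbf s}\in\mathbb R_+^{4N}$ for which there is a voltage vector $\mathbf V\in\mathbb C^N$ with nonzero entries that is $\Delta$-stable, i.e. $|V_j-\hat V_j|\le\Delta|\hat V_j|$ for all $j$, and that solves the power-flow equations $\mathbf V=V_0\mathbf 1-\mathbf Z\,\mathrm{diag}(\mathbf V^*)^{-1}\mathbf s^*$. Then $\mathbf Y_{LL}$ is nonsingular, and for the base point $(\hat{\mathbf V},\hat{\mathbf s})=(V_0\mathbf 1,\mathbf 0)$, with $\tilde{\hat{\mathbf s}}=\mathbf 0$, the following hold. 1. $P=\{\tilde{\mathbf s}\in\mathbb R_+^{4N}:(\mathbf A+\Delta\mathbf B)\tilde{\mathbf s}\le\Delta(1-\Delta)^2|V_0|^3\mathbf 1\}$. 2. If the voltages are normalized so that $|V_0|\le1$ (in particular in per-unit normalization, $|V_0|=1$), then this set is contained in $S$: each of its points admits a $\Delta$-stable power-flow solution. 3.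 For arbitrary $V_0\ne0$, $\{\tilde{\mathbf s}\in\mathbb R_+^{4N}:(\mathbf A+\Delta\mathbf B)\tilde{\mathbf s}\le\Delta(1-\Delta)^2|V_0|^2\mathbf 1\}\subseteq S$. -/

import Mathlib

open scoped Matrix Kronecker ComplexConjugate

noncomputable section

/-- A radial distribution network: a tree on the buses `0, 1, …, N`, rooted at the slack bus `0`,
whose lines carry a resistance and a reactance, both nonnegative and not both zero. -/
structure RadialNetwork (N : ℕ) where
  /-- The graph of the lines. -/
  graph : SimpleGraph (Fin (N + 1))
  isTree : graph.IsTree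
  /-- Resistance of a line. -/
  r : Sym2 (Fin (N + 1)) → ℝ
  /-- Reactance of a line. -/
  x : Sym2 (Fin (N + 1)) → ℝ
  r_nonneg : ∀ e ∈ graph.edgeSet, 0 ≤ r e
  x_nonneg : ∀ e ∈ graph.edgeSet, 0 ≤ x e
  impedance_ne_zero : ∀ e ∈ graph.edgeSet, (⟨r e, x e⟩ : ℂ) ≠ 0

namespace RadialNetwork

variable {N : ℕ} (net : RadialNetwork N)

/-- The impedance `z = r + i x` of a line. -/
def z (e : Sym2 (Fin (N + 1))) : ℂ := ⟨net.r e, net.x e⟩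

open Classical in
/-- The admittance `y = 1 / z` of a line, and `0` for a pair of buses not joined by a line. -/
def y (j k : Fin (N + 1)) : ℂ := if net.graph.Adj j k then 1 / net.z s(j, k) else 0

/-- The admittance bus matrix. -/
def Y : Matrix (Fin (N + 1)) (Fin (N + 1)) ℂ :=
  Matrix.of fun j k => if j = k then ∑ m ∈ Finset.univ.erase j, net.y j m else -net.y j k

/-- The reduced admittance matrix (rows and columns of the load buses `1, …, N`). -/
def YLL : Matrix (Fin N) (Fin N) ℂ := net.Y.submatrix Fin.succ Fin.succ

/-- The impedance bus matrix. -/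
def Z : Matrix (Fin N) (Fin N) ℂ := net.YLL⁻¹

/-- The lines on the unique path from bus `j` to the slack bus. -/
def pathEdges (j : Fin (N + 1)) : Finset (Sym2 (Fin (N + 1))) :=
  (net.isTree.existsUnique_path j 0).choose.edges.toFinset

/-- The resistance bus matrix: total resistance of the lines common to the paths
from `j` and from `k` to the slack bus. -/
def R : Matrix (Fin N) (Fin N) ℝ :=
  Matrix.of fun j k => ∑ e ∈ net.pathEdges j.succ ∩ net.pathEdges k.succ, net.r e

/-- The reactance bus matrix: total reactance of the lines common to the paths
from `j` and from `k` to the slack bus. -/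
def X : Matrix (Fin N) (Fin N) ℝ :=
  Matrix.of fun j k => ∑ e ∈ net.pathEdges j.succ ∩ net.pathEdges k.succ, net.x e

/-- The `4N × 4N` matrix `A`, in `4 × 4` blocks of size `N × N`. With `ρ` and `ξ` the
`(j, k)` entries of `R` and `X`, the entries `(j, k)` of the blocks are as displayed. -/
def A : Matrix (Fin 4 × Fin N) (Fin 4 × Fin N) ℝ :=
  Matrix.of fun a b =>
    let ρ : ℝ := net.R a.2 b.2
    let ξ : ℝ := net.X a.2 b.2
    !![-(ρ + ξ), -(-ρ + ξ), ρ + ξ, -ρ + ξ;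
       -(-ρ + ξ), -(-ρ - ξ), -ρ + ξ, -ρ - ξ;
       -(ρ - ξ), -(ρ + ξ), ρ - ξ, ρ + ξ;
       -(-ρ - ξ), -(ρ - ξ), -ρ - ξ, ρ - ξ] a.1 b.1

/-- The matrix `B = J₄ ⊗ (R + X)`, with `J₄` the all-ones matrix. -/
def B : Matrix (Fin 4 × Fin N) (Fin 4 × Fin N) ℝ :=
  (Matrix.of fun _ _ => 1 : Matrix (Fin 4) (Fin 4) ℝ) ⊗ₖ (net.R + net.X)

/-- The matrix `C = J₄ ⊗ |Z|`, with the entrywise modulus. -/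
def C : Matrix (Fin 4 × Fin N) (Fin 4 × Fin N) ℝ :=
  (Matrix.of fun _ _ => 1 : Matrix (Fin 4) (Fin 4) ℝ) ⊗ₖ net.Z.map (fun w => ‖w‖)

/-- The complex load vector `s = (p^c - p^g) + i (q^c - q^g)` of the split load vector
`(p^c, q^c, p^g, q^g)` (blocks `0, 1, 2, 3`). -/
def load (st : Fin 4 × Fin N → ℝ) (j : Fin N) : ℂ :=
  ⟨st (0, j) - st (2, j), st (1, j) - st (3, j)⟩

/-- The power-flow operator `G(V) = V₀ 1 - Z diag(V*)⁻¹ s*`. -/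
def G (V₀ : ℂ) (s V : Fin N → ℂ) : Fin N → ℂ :=
  (fun _ => V₀) - net.Z *ᵥ fun k => conj (s k) / conj (V k)

/-- `(V, s)` solves the power-flow equations. -/
def IsPowerFlowSolution (V₀ : ℂ) (V s : Fin N → ℂ) : Prop :=
  (∀ k, V k ≠ 0) ∧ net.G V₀ s V = V

/-- The set of `Δ`-stable voltage vectors around `Vh`. -/
def stableVoltages (Δ : ℝ) (Vh : Fin N → ℂ) : Set (Fin N → ℂ) :=
  {V | ∀ j, ‖V j - Vh j‖ ≤ Δ * ‖Vh j‖}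

/-- The feasibility region: the nonnegative split load vectors for which the power-flow
equations have a `Δ`-stable solution. -/
def feasibilityRegion (V₀ : ℂ) (Δ : ℝ) (Vh : Fin N → ℂ) : Set (Fin 4 × Fin N → ℝ) :=
  {st | 0 ≤ st ∧ ∃ V ∈ stableVoltages Δ Vh, net.IsPowerFlowSolution V₀ V (load st)}

/-- The polyhedral restriction around the base point with voltage `Vh` and split load `sth`. -/
def polyhedralRestriction (Δ : ℝ) (Vh : Fin N → ℂ) (sth : Fin 4 × Fin N → ℝ) :
    Set (Fin 4 × Fin N → ℝ) :=
  {st | 0 ≤ st ∧ (net.A + Δ • net.B) *ᵥ st ≤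
    (fun _ => Δ * (1 - Δ) ^ 2 * (⨅ j, ‖Vh j‖) ^ 3) +
      (net.A - Δ • (net.B + (1 - Δ) • net.C)) *ᵥ sth}

end RadialNetwork

end

/-! Power-flow solutions are the fixed points of `G`, sought in the product of discs
`stableVoltages`. Everything rests on `Z = R + iX`: column `k` of `R + iX` is the potential of a
unit current sent along the tree path from `k` to the slack bus, so `YLL` sends it to a unit vector
(`YLL_mul_RX`).

Hence the four block rows of `A` compute `±Re ± Im` of the linearized drop `Z s*`, while `B`
dominates `|Z||s|`. The linear constraints therefore bound `‖drop‖ + Δ * absDrop` at every bus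
(`norm_drop_add_le`). With the bound `Δ(1-Δ)²|V₀|²`, `G` maps the discs into themselves (`mapsTo_G`)
and, for `Δ > 0`, is nonexpansive there (`lipschitzOnWith_G`). Its Lipschitz constant may equal 1,
so Banach's theorem is replaced by a compactness argument on a convex set. If `|V₀| ≤ 1`, the cubic
bound implies the quadratic one. -/

/-! ### Fixed points of nonexpansive maps. -/

/-- A nonexpansive self-map of a nonempty compact convex set has a fixed point. -/
theorem exists_fixedPoint_of_nonexpansive {E : Type*} [NormedAddCommGroup E] [NormedSpace ℝ E]
    {s : Set E} (hs : IsCompact s) (hconv : Convex ℝ s) (hne : s.Nonempty) {f : E → E}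
    (hmaps : Set.MapsTo f s s) (hf : LipschitzOnWith 1 f s) : ∃ x ∈ s, f x = x := by
  obtain ⟨c, hc⟩ := hne
  obtain ⟨x, hx, hmin⟩ := hs.exists_isMinOn (f := fun x => ‖f x - x‖) ⟨c, hc⟩
    (hf.continuousOn.sub continuousOn_id).norm
  refine ⟨x, hx, ?_⟩
  obtain ⟨D, hD⟩ := hs.isBounded.exists_norm_le
  have approx : ∀ ε : ℝ, 0 < ε → ε < 1 → ‖f x - x‖ ≤ ε * (2 * D) := by
    intro ε hε hε1
    -- Pulling `f` towards `c` gives a strict contraction, whose fixed point is moved by `f` by at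
    -- most `ε` times a diameter bound.
    let g : E → E := fun y => (1 - ε) • f y + ε • c
    have hg : Set.MapsTo g s s := fun y hy =>
      hconv (hmaps hy) hc (by linarith) hε.le (by ring)
    have hlip : ContractingWith ⟨1 - ε, by linarith⟩ (hg.restrict g s s) := by
      refine ⟨show (1 - ε : ℝ) < 1 by linarith, LipschitzWith.of_dist_le_mul ?_⟩
      intro u v
      have huv := hf.dist_le_mul u u.2 v v.2
      rw [Subtype.dist_eq]
      change dist ((1 - ε) • f u + ε • c) ((1 - ε) • f v + ε • c) ≤ (1 - ε) * dist (u : E) v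
      rw [dist_add_right, dist_smul₀, Real.norm_of_nonneg (by linarith)]
      have : 0 ≤ 1 - ε := by linarith
      gcongr
      simpa using huv
    obtain ⟨y, hy, hfix, -⟩ := hlip.exists_fixedPoint' hs.isComplete hg hc (edist_ne_top _ _)
    have hfix' : (1 - ε) • f y + ε • c = y := hfix
    have hdiff : f y - y = ε • (f y - c) := by
      nth_rewrite 2 [← hfix']
      module
    calc ‖f x - x‖ ≤ ‖f y - y‖ := hmin hy
      _ = ε * ‖f y - c‖ := by rw [hdiff, norm_smul, Real.norm_of_nonneg hε.le]
      _ ≤ ε * (2 * D) := by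
        gcongr
        linarith [norm_sub_le (f y) c, hD _ (hmaps hy), hD _ hc]
  have hD0 : 0 ≤ D := (norm_nonneg _).trans (hD c hc)
  by_contra hne
  have hpos : 0 < ‖f x - x‖ := norm_pos_iff.2 (sub_ne_zero.2 hne)
  have h1 := approx (1 / 2) (by norm_num) (by norm_num)
  have hDpos : 0 < 2 * D := by linarith
  -- This `ε` turns the bound into `‖f x - x‖ ≤ ‖f x - x‖ / 2`.
  have hlt : ‖f x - x‖ / (2 * (2 * D)) < 1 := by rw [div_lt_one (by positivity)]; linarith
  have h2 := approx _ (by positivity) hlt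
  rw [div_mul_eq_mul_div, mul_div_mul_right _ _ hDpos.ne'] at h2
  linarith

/-! ### Unit flow along a walk. -/

namespace SimpleGraph.Walk

variable {V : Type*} {G : SimpleGraph V}

/-- The net number of times that a walk goes from `j` to `m`. -/
def netCrossings [DecidableEq V] (j m : V) : {u v : V} → G.Walk u v → ℤ
  | _, _, nil => 0
  | _, _, cons (u := u) (v := w) _ p =>
      (if u = j ∧ w = m then 1 else 0) - (if u = m ∧ w = j then 1 else 0) + p.netCrossings j m

theorem netCrossings_swap [DecidableEq V] (j m : V) {u v : V} (p : G.Walk u v) :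
    p.netCrossings m j = -p.netCrossings j m := by
  induction p with
  | nil => rfl
  | cons h p ih => simp only [netCrossings, ih]; ring

/-- Kirchhoff's current law for the unit flow along a walk. -/
theorem sum_netCrossings [DecidableEq V] [Fintype V] (j : V) {u v : V} (p : G.Walk u v) :
    ∑ m, p.netCrossings j m = (if u = j then 1 else 0) - (if v = j then 1 else 0) := by
  induction p with
  | nil => simp [netCrossings]
  | cons h p ih =>
    simp only [netCrossings, Finset.sum_add_distrib, Finset.sum_sub_distrib, ih]
    simp [ite_and]

theorem netCrossings_eq_zero [DecidableEq V] {j m u v : V} (p : G.Walk u v)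
    (h : s(j, m) ∉ p.edges) : p.netCrossings j m = 0 := by
  induction p with
  | nil => rfl
  | cons hadj p ih =>
    rw [edges_cons, List.mem_cons, not_or] at h
    rw [netCrossings, ih h.2, if_neg, if_neg]
    · rfl
    · rintro ⟨rfl, rfl⟩
      exact h.1 Sym2.eq_swap
    · rintro ⟨rfl, rfl⟩
      exact h.1 rfl

/-- If the path from `m` does not use the line `s(j, m)`, a path uses it at most once, and
only from `j` to `m`. -/
theorem netCrossings_eq_one [DecidableEq V] (hG : G.IsAcyclic) {j m v : V}
    {q : G.Walk m v} (hq : q.IsPath) (hjm : s(j, m) ∉ q.edges) {u : V} (p : G.Walk u v)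
    (hp : p.IsPath) (h : s(j, m) ∈ p.edges) : p.netCrossings j m = 1 := by
  induction p with
  | nil => simp at h
  | @cons a b _ hadj p ih =>
    have hnodup := hp.isTrail.edges_nodup
    rw [edges_cons, List.nodup_cons] at hnodup
    rw [edges_cons, List.mem_cons] at h
    -- A path starting with the step from `m` to `j` would be `q` by uniqueness, yet `q` avoids this
    -- line.
    have hnot : ¬ (a = m ∧ b = j) := by
      rintro ⟨rfl, rfl⟩
      apply hjm
      have heq : q = cons hadj p :=
        congrArg Subtype.val ((hG.subsingleton_path _ _).elim ⟨q, hq⟩ ⟨cons hadj p, hp⟩)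
      rw [heq]
      simp [Sym2.eq_swap]
    rw [netCrossings, if_neg hnot]
    by_cases hmem : s(j, m) ∈ p.edges
    · rw [ih hq hjm hp.of_cons hmem, if_neg]
      · rfl
      · rintro ⟨rfl, rfl⟩
        exact hnodup.1 hmem
    · have heq := h.resolve_right hmem
      rw [Sym2.eq_iff] at heq
      rw [netCrossings_eq_zero p hmem, if_pos]
      · rfl
      · rcases heq with ⟨h1, h2⟩ | ⟨h1, h2⟩
        · exact ⟨h1.symm, h2.symm⟩
        · exact absurd ⟨h2.symm, h1.symm⟩ hnot

end SimpleGraph.Walk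

/-! ### Inverting the reduced admittance matrix of a tree. -/

namespace RadialNetwork

variable {N : ℕ} (net : RadialNetwork N)

/-- The path from a bus to the slack bus. -/
noncomputable def path (j : Fin (N + 1)) : net.graph.Walk j 0 := (net.isTree.existsUnique_path j 0).choose

theorem path_isPath (j : Fin (N + 1)) : (net.path j).IsPath :=
  (net.isTree.existsUnique_path j 0).choose_spec.1

theorem eq_path {j : Fin (N + 1)} {p : net.graph.Walk j 0} (hp : p.IsPath) : p = net.path j :=
  (net.isTree.existsUnique_path j 0).choose_spec.2 p hp

theorem mem_pathEdges {j : Fin (N + 1)} {e : Sym2 (Fin (N + 1))} :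
    e ∈ net.pathEdges j ↔ e ∈ (net.path j).edges := List.mem_toFinset

theorem pathEdges_zero : net.pathEdges 0 = ∅ := by
  ext e
  rw [mem_pathEdges, ← net.eq_path SimpleGraph.Walk.IsPath.nil]
  simp

theorem mem_edgeSet_of_mem_pathEdges {j : Fin (N + 1)} {e : Sym2 (Fin (N + 1))}
    (h : e ∈ net.pathEdges j) : e ∈ net.graph.edgeSet :=
  SimpleGraph.Walk.edges_subset_edgeSet _ (net.mem_pathEdges.1 h)

/-- The total impedance of the lines common to the paths of two buses to the slack bus. -/
noncomputable def commonImpedance (j k : Fin (N + 1)) : ℂ :=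
  ∑ e ∈ net.pathEdges j ∩ net.pathEdges k, net.z e

/-- Of two adjacent buses, one lies behind the other as seen from the slack bus. -/
theorem path_eq_cons_or {j m : Fin (N + 1)} (h : net.graph.Adj j m) :
    net.path j = .cons h (net.path m) ∨ net.path m = .cons h.symm (net.path j) := by
  by_cases hj : j ∈ (net.path m).support
  · right
    have hm : m ∉ (net.path j).support := by
      have := net.isTree.isAcyclic.ne_mem_support_of_support_of_adj_of_isPath
        (net.path_isPath m).reverse (net.path_isPath j).reverse h.symm
        (by simpa using hj)
      simpa using this
    exact (net.eq_path ((net.path_isPath j).cons hm)).symm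
  · left
    exact (net.eq_path ((net.path_isPath m).cons hj)).symm

/-- The paths of `j` and `m` differ only by the line `s(j, m)`, which contributes exactly when the
path of `k` uses it, and then in the direction from `j` to `m`. -/
theorem commonImpedance_sub_of_path_eq_cons {j m : Fin (N + 1)} (h : net.graph.Adj j m)
    (hpath : net.path j = .cons h (net.path m)) (k : Fin (N + 1)) :
    net.commonImpedance j k - net.commonImpedance m k =
      net.z s(j, m) * (net.path k).netCrossings j m := by
  have hnot : s(j, m) ∉ (net.path m).edges := by
    have := (net.path_isPath j).isTrail.edges_nodup
    rw [hpath, SimpleGraph.Walk.edges_cons, List.nodup_cons] at this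
    exact this.1
  have hins : net.pathEdges j = insert s(j, m) (net.pathEdges m) := by
    ext e
    rw [Finset.mem_insert, mem_pathEdges, mem_pathEdges, hpath, SimpleGraph.Walk.edges_cons,
      List.mem_cons]
  unfold commonImpedance
  rw [hins]
  by_cases hk : s(j, m) ∈ (net.path k).edges
  · rw [SimpleGraph.Walk.netCrossings_eq_one net.isTree.isAcyclic (net.path_isPath m) hnot _
      (net.path_isPath k) hk, Finset.insert_inter_of_mem (net.mem_pathEdges.2 hk),
      Finset.sum_insert]
    · simp
    · rw [Finset.mem_inter, mem_pathEdges]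
      exact fun hmem => hnot hmem.1
  · rw [SimpleGraph.Walk.netCrossings_eq_zero _ hk,
      Finset.insert_inter_of_notMem fun hmem => hk (net.mem_pathEdges.1 hmem)]
    simp

/-- Ohm's law. -/
theorem commonImpedance_sub {j m : Fin (N + 1)} (h : net.graph.Adj j m) (k : Fin (N + 1)) :
    net.commonImpedance j k - net.commonImpedance m k =
      net.z s(j, m) * (net.path k).netCrossings j m := by
  rcases net.path_eq_cons_or h with hpath | hpath
  · exact net.commonImpedance_sub_of_path_eq_cons h hpath k
  · have := net.commonImpedance_sub_of_path_eq_cons h.symm hpath k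
    rw [SimpleGraph.Walk.netCrossings_swap, Sym2.eq_swap] at this
    push_cast at this
    linear_combination -this

theorem y_mul_commonImpedance_sub (j m k : Fin (N + 1)) :
    net.y j m * (net.commonImpedance j k - net.commonImpedance m k) =
      (net.path k).netCrossings j m := by
  unfold y
  split_ifs with h
  · have hz : net.z s(j, m) ≠ 0 := net.impedance_ne_zero _ h
    rw [net.commonImpedance_sub h]
    field_simp
  · rw [SimpleGraph.Walk.netCrossings_eq_zero, zero_mul, Int.cast_zero]
    exact fun hmem => h ((net.path k).adj_of_mem_edges hmem)

/-- By Ohm's law the line currents form the unit flow from `k` to the slack bus, so the net current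
leaving `j` is given by Kirchhoff's law. -/
theorem sum_Y_mul_commonImpedance (j k : Fin (N + 1)) :
    ∑ m, net.Y j m * net.commonImpedance m k =
      (if k = j then 1 else 0) - (if 0 = j then 1 else 0) := by
  have h := congrArg (Int.cast : ℤ → ℂ) ((net.path k).sum_netCrossings j)
  push_cast at h
  rw [← h]
  simp_rw [← y_mul_commonImpedance_sub]
  rw [← Finset.add_sum_erase _ _ (Finset.mem_univ j),
    ← Finset.add_sum_erase _ (fun m => net.y j m * _) (Finset.mem_univ j)]
  simp only [Y, Matrix.of_apply, if_true, sub_self, mul_zero, zero_add, Finset.sum_mul]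
  rw [← Finset.sum_add_distrib]
  refine Finset.sum_congr rfl fun m hm => ?_
  rw [if_neg (Finset.ne_of_mem_erase hm).symm]
  ring

/-- The matrix `R + i X`. -/
noncomputable def RX : Matrix (Fin N) (Fin N) ℂ := Matrix.of fun j k => ⟨net.R j k, net.X j k⟩

theorem RX_apply (j k : Fin N) : net.RX j k = net.commonImpedance j.succ k.succ := by
  apply Complex.ext <;> simp [RX, commonImpedance, R, X, z]

theorem YLL_mul_RX : net.YLL * net.RX = 1 := by
  ext j k
  have h := net.sum_Y_mul_commonImpedance j.succ k.succ
  rw [Fin.sum_univ_succ] at h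
  -- The slack bus has potential zero, so deleting its column loses nothing.
  have h0 : net.commonImpedance 0 k.succ = 0 := by simp [commonImpedance, pathEdges_zero]
  rw [h0, mul_zero, zero_add, if_neg (Fin.succ_ne_zero j).symm, sub_zero] at h
  simp only [Matrix.mul_apply, RX_apply, YLL, Matrix.submatrix_apply, h, Matrix.one_apply,
    Fin.succ_inj, eq_comm]

theorem isUnit_YLL : IsUnit net.YLL := by
  rw [Matrix.isUnit_iff_isUnit_det]
  exact Matrix.isUnit_det_of_right_inverse net.YLL_mul_RX

/-- In a radial network, the impedance bus matrix is `R + i X`. -/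
theorem Z_eq_RX : net.Z = net.RX := Matrix.inv_eq_right_inv net.YLL_mul_RX

/-! ### Consequences of the linear constraints. -/

theorem R_nonneg (j k : Fin N) : 0 ≤ net.R j k :=
  Finset.sum_nonneg fun e he => net.r_nonneg e
    (net.mem_edgeSet_of_mem_pathEdges (Finset.mem_inter.1 he).1)

theorem X_nonneg (j k : Fin N) : 0 ≤ net.X j k :=
  Finset.sum_nonneg fun e he => net.x_nonneg e
    (net.mem_edgeSet_of_mem_pathEdges (Finset.mem_inter.1 he).1)

theorem norm_Z_le (j k : Fin N) : ‖net.Z j k‖ ≤ net.R j k + net.X j k := by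
  have h := Complex.norm_le_abs_re_add_abs_im (net.Z j k)
  rw [Z_eq_RX] at h ⊢
  change _ ≤ |net.R j k| + |net.X j k| at h
  rwa [abs_of_nonneg (net.R_nonneg j k), abs_of_nonneg (net.X_nonneg j k)] at h

theorem norm_load_le {st : Fin 4 × Fin N → ℝ} (hst : 0 ≤ st) (k : Fin N) :
    ‖load st k‖ ≤ ∑ a, st (a, k) := by
  refine (Complex.norm_le_abs_re_add_abs_im _).trans ?_
  change |st (0, k) - st (2, k)| + |st (1, k) - st (3, k)| ≤ _
  have h0 : 0 ≤ st (0, k) := hst _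
  have h1 : 0 ≤ st (1, k) := hst _
  have h2 : 0 ≤ st (2, k) := hst _
  have h3 : 0 ≤ st (3, k) := hst _
  rw [Fin.sum_univ_four]
  have hp : |st (0, k) - st (2, k)| ≤ st (0, k) + st (2, k) :=
    abs_le.2 ⟨by linarith, by linarith⟩
  have hq : |st (1, k) - st (3, k)| ≤ st (1, k) + st (3, k) :=
    abs_le.2 ⟨by linarith, by linarith⟩
  linarith

/-- The entrywise modulus of `Z`, applied to the moduli of a load vector. -/
noncomputable def absDrop (s : Fin N → ℂ) (j : Fin N) : ℝ := ∑ k, ‖net.Z j k‖ * ‖s k‖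

theorem absDrop_le_B_mulVec {st : Fin 4 × Fin N → ℝ} (hst : 0 ≤ st) (a : Fin 4) (j : Fin N) :
    net.absDrop (load st) j ≤ (net.B *ᵥ st) (a, j) := by
  simp only [absDrop, B, Matrix.mulVec, dotProduct, Fintype.sum_prod_type,
    Matrix.kroneckerMap_apply, Matrix.of_apply, Matrix.add_apply, one_mul]
  rw [Finset.sum_comm]
  simp_rw [← Finset.mul_sum]
  gcongr with k
  · exact add_nonneg (net.R_nonneg j k) (net.X_nonneg j k)
  · exact net.norm_Z_le j k
  · exact norm_load_le hst k

/-- The linearized voltage drop `Z s*`. -/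
noncomputable def drop (s : Fin N → ℂ) : Fin N → ℂ := net.Z *ᵥ fun k => conj (s k)

theorem A_mulVec (st : Fin 4 × Fin N → ℝ) (a : Fin 4) (j : Fin N) :
    (net.A *ᵥ st) (a, j) =
      ![-(net.drop (load st) j).re - (net.drop (load st) j).im,
        (net.drop (load st) j).re - (net.drop (load st) j).im,
        -(net.drop (load st) j).re + (net.drop (load st) j).im,
        (net.drop (load st) j).re + (net.drop (load st) j).im] a := by
  have hre : (net.drop (load st) j).re = ∑ k, (net.R j k * (st (0, k) - st (2, k)) +
      net.X j k * (st (1, k) - st (3, k))) := by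
    simp only [drop, Z_eq_RX, Matrix.mulVec, dotProduct, Complex.re_sum, Complex.mul_re, RX, load,
      Matrix.of_apply, Complex.conj_re, Complex.conj_im]
    exact Finset.sum_congr rfl fun k _ => by ring
  have him : (net.drop (load st) j).im = ∑ k, (net.X j k * (st (0, k) - st (2, k)) -
      net.R j k * (st (1, k) - st (3, k))) := by
    simp only [drop, Z_eq_RX, Matrix.mulVec, dotProduct, Complex.im_sum, Complex.mul_im, RX, load,
      Matrix.of_apply, Complex.conj_re, Complex.conj_im]
    exact Finset.sum_congr rfl fun k _ => by ring
  rw [hre, him]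
  simp only [Matrix.mulVec, dotProduct, Fintype.sum_prod_type, Fin.sum_univ_four, A,
    Matrix.of_apply]
  fin_cases a <;>
  · simp only [← Finset.sum_add_distrib, ← Finset.sum_sub_distrib, ← Finset.sum_neg_distrib,
      Fin.mk_one, Fin.zero_eta, Fin.reduceFinMk, Matrix.cons_val]
    exact Finset.sum_congr rfl fun k _ => by ring

/-- The four blocks realize all sign choices in `±Re ± Im`; together they bound `|Re| + |Im|`, which
dominates the modulus. -/
theorem norm_drop_add_le {Δ c : ℝ} (hΔ : 0 ≤ Δ) {st : Fin 4 × Fin N → ℝ} (hst : 0 ≤ st)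
    (h : (net.A + Δ • net.B) *ᵥ st ≤ fun _ => c) (j : Fin N) :
    ‖net.drop (load st) j‖ + Δ * net.absDrop (load st) j ≤ c := by
  have key : ∀ a, (net.A *ᵥ st) (a, j) + Δ * net.absDrop (load st) j ≤ c := fun a => by
    have h1 := h (a, j)
    rw [Matrix.add_mulVec, Matrix.smul_mulVec, Pi.add_apply, Pi.smul_apply, smul_eq_mul] at h1
    linarith [mul_le_mul_of_nonneg_left (net.absDrop_le_B_mulVec hst a j) hΔ]
  have h0 := key 0
  have h1 := key 1
  have h2 := key 2
  have h3 := key 3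
  rw [A_mulVec] at h0 h1 h2 h3
  simp only [Matrix.cons_val] at h0 h1 h2 h3
  have hn := Complex.norm_le_abs_re_add_abs_im (net.drop (load st) j)
  rcases abs_cases (net.drop (load st) j).re with ⟨ha, -⟩ | ⟨ha, -⟩ <;>
    rcases abs_cases (net.drop (load st) j).im with ⟨hb, -⟩ | ⟨hb, -⟩ <;> linarith

/-! ### The power-flow operator on stable voltages. -/

theorem le_norm_of_mem_stableVoltages {Δ : ℝ} {V₀ : ℂ} {V : Fin N → ℂ}
    (hV : V ∈ stableVoltages Δ fun _ => V₀) (j : Fin N) : (1 - Δ) * ‖V₀‖ ≤ ‖V j‖ := by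
  have h1 := hV j
  have h2 := norm_sub_norm_le V₀ (V j)
  simp only at h1
  rw [norm_sub_rev] at h2
  linarith

theorem norm_Z_mulVec_le (s : Fin N → ℂ) (d : Fin N → ℂ) {c : ℝ} (hd : ∀ k, ‖d k‖ ≤ c)
    (j : Fin N) : ‖(net.Z *ᵥ fun k => conj (s k) * d k) j‖ ≤ net.absDrop s j * c := by
  simp only [Matrix.mulVec, dotProduct]
  refine (norm_sum_le _ _).trans ?_
  rw [absDrop, Finset.sum_mul]
  refine Finset.sum_le_sum fun k _ => ?_
  rw [norm_mul, norm_mul, RCLike.norm_conj, ← mul_assoc]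
  exact mul_le_mul_of_nonneg_left (hd k) (by positivity)

theorem norm_inv_conj_sub_inv_conj_le {v w : ℂ} {a b : ℝ} (ha : 0 < a) (hb : 0 < b)
    (hv : a ≤ ‖v‖) (hw : b ≤ ‖w‖) : ‖(conj v)⁻¹ - (conj w)⁻¹‖ ≤ ‖v - w‖ / (a * b) := by
  have hv0 : v ≠ 0 := norm_pos_iff.1 (ha.trans_le hv)
  have hw0 : w ≠ 0 := norm_pos_iff.1 (hb.trans_le hw)
  rw [← map_inv₀, ← map_inv₀, ← map_sub, RCLike.norm_conj, inv_sub_inv hv0 hw0, norm_div,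
    norm_mul, norm_sub_rev]
  gcongr

theorem G_sub_G (V₀ : ℂ) (s V W : Fin N → ℂ) (j : Fin N) :
    net.G V₀ s V j - net.G V₀ s W j =
      -(net.Z *ᵥ fun k => conj (s k) * ((conj (V k))⁻¹ - (conj (W k))⁻¹)) j := by
  simp only [G, Pi.sub_apply, Matrix.mulVec, dotProduct, div_eq_mul_inv, mul_sub,
    Finset.sum_sub_distrib]
  ring

theorem G_const_sub (V₀ : ℂ) (s : Fin N → ℂ) (j : Fin N) :
    net.G V₀ s (fun _ => V₀) j - V₀ = -(net.drop s j / conj V₀) := by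
  simp only [G, drop, Pi.sub_apply, Matrix.mulVec, dotProduct, Finset.sum_div, ← mul_div_assoc]
  ring

/-- Under the linear constraints, the power-flow operator preserves the stable voltages. -/
theorem mapsTo_G {V₀ : ℂ} (hV₀ : V₀ ≠ 0) {Δ : ℝ} (hΔ₀ : 0 ≤ Δ) (hΔ₁ : Δ < 1) {s : Fin N → ℂ}
    (h : ∀ j, ‖net.drop s j‖ + Δ * net.absDrop s j ≤ Δ * (1 - Δ) ^ 2 * ‖V₀‖ ^ 2) :
    Set.MapsTo (net.G V₀ s) (stableVoltages Δ fun _ => V₀) (stableVoltages Δ fun _ => V₀) := by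
  intro V hV j
  have hn : 0 < ‖V₀‖ := norm_pos_iff.2 hV₀
  have hδ : 0 < 1 - Δ := by linarith
  -- Only `V k` needs the lower bound `(1 - Δ)‖V₀‖`; comparing with the centre `V₀` costs a single
  -- factor `1 - Δ`, which leaves one to spare at the end.
  have hinv : ∀ k, ‖(conj (V k))⁻¹ - (conj V₀)⁻¹‖ ≤ Δ / ((1 - Δ) * ‖V₀‖) := fun k => by
    refine (norm_inv_conj_sub_inv_conj_le (mul_pos hδ hn) hn
      (le_norm_of_mem_stableVoltages hV k) le_rfl).trans ?_
    rw [div_le_div_iff₀ (by positivity) (by positivity)]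
    have := mul_le_mul_of_nonneg_right (hV k) (by positivity : 0 ≤ (1 - Δ) * ‖V₀‖)
    linarith
  have h1 := net.norm_Z_mulVec_le s _ hinv j
  have h2 : net.G V₀ s V j - V₀ = (net.G V₀ s V j - net.G V₀ s (fun _ => V₀) j) +
      (net.G V₀ s (fun _ => V₀) j - V₀) := by ring
  have hb : ‖net.drop s j‖ * (1 - Δ) + Δ * net.absDrop s j ≤ Δ * (1 - Δ) ^ 2 * ‖V₀‖ ^ 2 := by
    nlinarith [h j, norm_nonneg (net.drop s j)]
  calc ‖net.G V₀ s V j - V₀‖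
      ≤ net.absDrop s j * (Δ / ((1 - Δ) * ‖V₀‖)) + ‖net.drop s j‖ / ‖V₀‖ := by
        rw [h2, G_sub_G, G_const_sub]
        refine (norm_add_le _ _).trans ?_
        rw [norm_neg, norm_neg, norm_div, RCLike.norm_conj]
        gcongr
    _ = (‖net.drop s j‖ * (1 - Δ) + Δ * net.absDrop s j) / ((1 - Δ) * ‖V₀‖) := by
        field_simp
        ring
    _ ≤ Δ * (1 - Δ) ^ 2 * ‖V₀‖ ^ 2 / ((1 - Δ) * ‖V₀‖) := by gcongr
    _ = (1 - Δ) * (Δ * ‖V₀‖) := by field_simp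
    _ ≤ Δ * ‖V₀‖ := by nlinarith [mul_nonneg hΔ₀ hn.le]

/-- Under a bound on the moduli of the loads, the power-flow operator is nonexpansive on the
stable voltages, in the maximum norm. -/
theorem lipschitzOnWith_G {V₀ : ℂ} (hV₀ : V₀ ≠ 0) {Δ : ℝ} (hΔ₁ : Δ < 1) {s : Fin N → ℂ}
    (h : ∀ j, net.absDrop s j ≤ (1 - Δ) ^ 2 * ‖V₀‖ ^ 2) :
    LipschitzOnWith 1 (net.G V₀ s) (stableVoltages Δ fun _ => V₀) := by
  refine LipschitzOnWith.of_dist_le_mul fun V hV W hW => ?_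
  rw [NNReal.coe_one, one_mul, dist_pi_le_iff dist_nonneg]
  intro j
  have hn : 0 < ‖V₀‖ := norm_pos_iff.2 hV₀
  have hδ : 0 < (1 - Δ) * ‖V₀‖ := mul_pos (by linarith) hn
  have hinv : ∀ k, ‖(conj (V k))⁻¹ - (conj (W k))⁻¹‖ ≤
      dist V W / ((1 - Δ) * ‖V₀‖ * ((1 - Δ) * ‖V₀‖)) := fun k => by
    refine (norm_inv_conj_sub_inv_conj_le hδ hδ (le_norm_of_mem_stableVoltages hV k)
      (le_norm_of_mem_stableVoltages hW k)).trans ?_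
    rw [← dist_eq_norm]
    gcongr
    exact dist_le_pi_dist V W k
  rw [dist_eq_norm, G_sub_G, norm_neg]
  refine (net.norm_Z_mulVec_le s _ hinv j).trans ?_
  rw [mul_div_assoc', div_le_iff₀ (by positivity), mul_comm]
  exact mul_le_mul_of_nonneg_left ((h j).trans_eq (by ring)) dist_nonneg

theorem stableVoltages_eq_pi (Δ : ℝ) (V₀ : ℂ) :
    stableVoltages Δ (fun _ : Fin N => V₀) =
      Set.univ.pi fun _ => Metric.closedBall V₀ (Δ * ‖V₀‖) := by
  ext V
  simp [stableVoltages, dist_eq_norm]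

theorem mem_feasibilityRegion {V₀ : ℂ} (hV₀ : V₀ ≠ 0) {Δ : ℝ} (hΔ₀ : 0 ≤ Δ) (hΔ₁ : Δ < 1)
    {st : Fin 4 × Fin N → ℝ} (hst : 0 ≤ st)
    (h : (net.A + Δ • net.B) *ᵥ st ≤ fun _ => Δ * (1 - Δ) ^ 2 * ‖V₀‖ ^ 2) :
    st ∈ net.feasibilityRegion V₀ Δ fun _ => V₀ := by
  have hn : 0 < ‖V₀‖ := norm_pos_iff.2 hV₀
  have hδ : 0 < 1 - Δ := by linarith
  have hdrop := net.norm_drop_add_le hΔ₀ hst h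
  have hmaps := net.mapsTo_G hV₀ hΔ₀ hΔ₁ hdrop
  have hmem : (fun _ : Fin N => V₀) ∈ stableVoltages Δ fun _ => V₀ := fun _ => by
    simpa using mul_nonneg hΔ₀ hn.le
  have hfix : ∃ V ∈ stableVoltages Δ fun _ => V₀, net.G V₀ (load st) V = V := by
    -- For `Δ = 0` the constraints say nothing about `absDrop`, but the only stable voltage is `V₀`,
    -- which the self-mapping property fixes.
    rcases hΔ₀.eq_or_lt with rfl | hΔpos
    · refine ⟨_, hmem, funext fun j => ?_⟩
      have := hmaps hmem j
      rwa [zero_mul, norm_le_zero_iff, sub_eq_zero] at this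
    · refine exists_fixedPoint_of_nonexpansive ?_ ?_ ⟨_, hmem⟩ hmaps
        (net.lipschitzOnWith_G hV₀ hΔ₁ fun j => ?_)
      · rw [stableVoltages_eq_pi]
        exact isCompact_univ_pi fun _ => isCompact_closedBall _ _
      · rw [stableVoltages_eq_pi]
        exact convex_pi fun _ _ => convex_closedBall _ _
      · refine le_of_mul_le_mul_left ?_ hΔpos
        linarith [hdrop j, norm_nonneg (net.drop (load st) j)]
  obtain ⟨V, hV, hG⟩ := hfix
  exact ⟨hst, V, hV, fun k => norm_pos_iff.1
    ((mul_pos hδ hn).trans_le (le_norm_of_mem_stableVoltages hV k)), hG⟩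

theorem polyhedralRestriction_const_zero (Δ : ℝ) (V₀ : ℂ) :
    net.polyhedralRestriction Δ (fun _ => V₀) 0 =
      {st : Fin 4 × Fin N → ℝ | 0 ≤ st ∧
        (net.A + Δ • net.B) *ᵥ st ≤ fun _ => Δ * (1 - Δ) ^ 2 * ‖V₀‖ ^ 3} := by
  unfold polyhedralRestriction
  rw [Matrix.mulVec_zero, add_zero]
  -- Without load buses the infimum takes the default value 0 instead of `‖V₀‖`, but there are then
  -- no inequalities to compare.
  rcases isEmpty_or_nonempty (Fin N) with hN | hN
  · ext st
    exact and_congr_right fun _ => ⟨fun _ i => isEmptyElim i.2, fun _ i => isEmptyElim i.2⟩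
  · rw [ciInf_const]

end RadialNetwork

theorem corollary1 {N : ℕ} (net : RadialNetwork N) (V₀ : ℂ) (hV₀ : V₀ ≠ 0)
    (Δ : ℝ) (hΔ₀ : 0 ≤ Δ) (hΔ₁ : Δ < 1) :
    -- the impedance bus matrix is a genuine inverse
    IsUnit net.YLL ∧
    -- the restriction at the base point without load is the announced polyhedron
    net.polyhedralRestriction Δ (fun _ => V₀) 0 =
      {st : Fin 4 × Fin N → ℝ | 0 ≤ st ∧
        (net.A + Δ • net.B) *ᵥ st ≤ fun _ => Δ * (1 - Δ) ^ 2 * ‖V₀‖ ^ 3} ∧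
    -- all of its points are feasible, voltages being normalized
    (‖V₀‖ ≤ 1 →
      {st : Fin 4 × Fin N → ℝ | 0 ≤ st ∧
        (net.A + Δ • net.B) *ᵥ st ≤ fun _ => Δ * (1 - Δ) ^ 2 * ‖V₀‖ ^ 3} ⊆
      net.feasibilityRegion V₀ Δ (fun _ => V₀)) ∧
    -- the same in arbitrary units of voltage
    {st : Fin 4 × Fin N → ℝ | 0 ≤ st ∧
        (net.A + Δ • net.B) *ᵥ st ≤ fun _ => Δ * (1 - Δ) ^ 2 * ‖V₀‖ ^ 2} ⊆
      net.feasibilityRegion V₀ Δ (fun _ => V₀) := by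
  refine ⟨net.isUnit_YLL, net.polyhedralRestriction_const_zero Δ V₀, ?_, ?_⟩
  · rintro hV₁ st ⟨hst, h⟩
    refine net.mem_feasibilityRegion hV₀ hΔ₀ hΔ₁ hst (h.trans fun _ => ?_)
    have hδ : 0 ≤ 1 - Δ := by linarith
    exact mul_le_mul_of_nonneg_left
      (pow_le_pow_of_le_one (norm_nonneg _) hV₁ (by norm_num)) (by positivity)
  · rintro st ⟨hst, h⟩
    exact net.mem_feasibilityRegion hV₀ hΔ₀ hΔ₁ hst h
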